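/- For $n\in\mathbb N_0$ let $L_n=(\mathbb C^2)^{\otimes_S n}\subseteq(\mathbb C^2)^{\otimes n}$ be the Hilbert space of symmetric tensors (with $L_0=\mathbb C$), and let $\rho_n:SU(2)\to U(L_n)$ be the restriction of the $n$-fold tensor power of the fundamental representation of $SU(2)$ on $\mathbb C^2$. For a unitary representation $\tau:SU(2)\to U(H)$ on a finite-dimensional complex Hilbert space put $$\det(\tau,H)=\{\xi\in H\otimes H \mid (\tau(g)\otimes\tau(g))\xi=\xi\ \text{ for all } g\in SU(2)\}.$$ Let $\tau:SU(2)\to U(H)$ be a strongly continuous unitary representation on a finite-dimensional Hilbert space $H$, let $k_m\in\mathbb N_0$ for $m\in\mathbb N_0$, and let $V:\bigoplus_{m=0}^\infty L_m^{\oplus k_m}\to H$ be a unitary operator intertwining $\bigoplus_{m=0}^\infty\rho_m^{\oplus k_m}$ and $\tau$ (so that $k_m=0$ for all but finitely many $m$). Then $\det(\tau,H)\subseteq H\otimes H$ has dimension $\sum_{m=0}^\infty k_m^2$. Moreover the isometry $$\bigoplus_{m=0}^\infty(L_m\otimes L_m)^{\oplus k_m^2}\;\cong\;\bigoplus_{m=0}^\infty\bigl(L_m^{\oplus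 k_m}\otimes L_m^{\oplus k_m}\bigr)\xrightarrow{\ \iota\ }H\otimes H,$$ where the first map is the canonical unitary identification (the $k_m^2$ copies being indexed by pairs $(i,j)$ with $1\le i,j\le k_m$) and $\iota$ is given in degree $m$ by $\iota(\xi_m\otimes\eta_m)=V(\xi_m\delta_m)\otimes V(\eta_m\delta_m)$, with $\xi_m\delta_m$ denoting the vector $\xi_m\in L_m^{\oplus k_m}$ placed in the $m$-th summand, restricts to a unitary isomorphism from the subspace $$\bigoplus_{m=0}^\infty\det(\rho_m,L_m)^{\oplus k_m^2}\subseteq\bigoplus_{m=0}^\infty(L_m\otimes L_m)^{\oplus k_m^2}$$ onto $\det(\tau,H)$. -/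

import Mathlib

open scoped TensorProduct InnerProductSpace

noncomputable section

namespace SU2Det

/-- The group `SU(2)`, with the topology of a subspace of the complex `2 × 2` matrices. -/
abbrev SU2 : Type := Matrix.specialUnitaryGroup (Fin 2) ℂ

/-- The Hilbert space `ℂ²`. -/
abbrev C2 : Type := EuclideanSpace ℂ (Fin 2)

/-! ### The Hilbert space `(ℂ²)^{⊗ n}` -/

/-- The tensor power `(ℂ²)^{⊗ n}`. (A type synonym, since Mathlib equips `PiTensorProduct` itself
with the projective norm instead of the Hilbert space norm.) -/
def TensorPow (n : ℕ) : Type := ⨂[ℂ] _ : Fin n, C2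

instance (n : ℕ) : AddCommGroup (TensorPow n) :=
  inferInstanceAs (AddCommGroup (⨂[ℂ] _ : Fin n, C2))

instance (n : ℕ) : Module ℂ (TensorPow n) :=
  inferInstanceAs (Module ℂ (⨂[ℂ] _ : Fin n, C2))

/-- The elementary tensor `x₁ ⊗ ⋯ ⊗ xₙ`. -/
def TensorPow.tprod {n : ℕ} (x : Fin n → C2) : TensorPow n := PiTensorProduct.tprod ℂ x

/-- The basis `f_{p 1} ⊗ ⋯ ⊗ f_{p n}` of `(ℂ²)^{⊗ n}`, where `f₀, f₁` is the standard basis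
of `ℂ²`. -/
def TensorPow.basis (n : ℕ) : Module.Basis (Fin n → Fin 2) ℂ (TensorPow n) :=
  Basis.piTensorProduct fun _ : Fin n => (EuclideanSpace.basisFun (Fin 2) ℂ).toBasis

/-- The coordinates with respect to `TensorPow.basis`. -/
def TensorPow.coords (n : ℕ) : TensorPow n ≃ₗ[ℂ] EuclideanSpace ℂ (Fin n → Fin 2) :=
  (TensorPow.basis n).equivFun ≪≫ₗ (WithLp.linearEquiv 2 ℂ ((Fin n → Fin 2) → ℂ)).symm

/-- The norm for which `TensorPow.basis` is orthonormal. -/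
instance (n : ℕ) : NormedAddCommGroup (TensorPow n) :=
  NormedAddCommGroup.induced _ _ (TensorPow.coords n) (TensorPow.coords n).injective

/-- The inner product for which `TensorPow.basis` is orthonormal; by `TensorPow.inner_tprod` it is
the usual one. -/
instance (n : ℕ) : InnerProductSpace ℂ (TensorPow n) :=
  InnerProductSpace.induced (TensorPow.coords n)

theorem TensorPow.inner_def {n : ℕ} (x y : TensorPow n) :
    ⟪x, y⟫_ℂ = ⟪TensorPow.coords n x, TensorPow.coords n y⟫_ℂ := rfl

theorem TensorPow.coords_tprod {n : ℕ} (x : Fin n → C2) (p : Fin n → Fin 2) :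
    TensorPow.coords n (TensorPow.tprod x) p = ∏ i, x i (p i) := by
  have h := Basis.piTensorProduct_repr_tprod_apply
    (fun _ : Fin n => (EuclideanSpace.basisFun (Fin 2) ℂ).toBasis) x p
  rw [show TensorPow.coords n (TensorPow.tprod x) p
    = (Basis.piTensorProduct fun _ : Fin n => (EuclideanSpace.basisFun (Fin 2) ℂ).toBasis).repr
      (PiTensorProduct.tprod ℂ x) p from rfl, h]
  simp

/-- `⟪x₁ ⊗ ⋯ ⊗ xₙ, y₁ ⊗ ⋯ ⊗ yₙ⟫ = ∏ i, ⟪xᵢ, yᵢ⟫`. -/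
theorem TensorPow.inner_tprod {n : ℕ} (x y : Fin n → C2) :
    ⟪TensorPow.tprod x, TensorPow.tprod y⟫_ℂ = ∏ i, ⟪x i, y i⟫_ℂ := by
  rw [TensorPow.inner_def]
  simp only [PiLp.inner_apply, TensorPow.coords_tprod]
  rw [Finset.prod_univ_sum]
  simp [Finset.prod_mul_distrib]

theorem TensorPow.span_tprod (n : ℕ) :
    Submodule.span ℂ (Set.range (TensorPow.tprod (n := n))) = ⊤ :=
  PiTensorProduct.span_tprod_eq_top

/-- The operator `e ⊗ ⋯ ⊗ e` on `(ℂ²)^{⊗ n}` for an invertible operator `e` on `ℂ²`. -/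
def TensorPow.congr (n : ℕ) (e : C2 ≃ₗ[ℂ] C2) : TensorPow n ≃ₗ[ℂ] TensorPow n :=
  (PiTensorProduct.congr fun _ : Fin n => e :
    (⨂[ℂ] _ : Fin n, C2) ≃ₗ[ℂ] (⨂[ℂ] _ : Fin n, C2))

theorem TensorPow.congr_tprod {n : ℕ} (e : C2 ≃ₗ[ℂ] C2) (x : Fin n → C2) :
    TensorPow.congr n e (TensorPow.tprod x) = TensorPow.tprod fun i => e (x i) :=
  PiTensorProduct.congr_tprod (fun _ : Fin n => e) x

theorem TensorPow.inner_congr {n : ℕ} (e : C2 ≃ₗᵢ[ℂ] C2) (x y : TensorPow n) :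
    ⟪TensorPow.congr n e.toLinearEquiv x, TensorPow.congr n e.toLinearEquiv y⟫_ℂ = ⟪x, y⟫_ℂ := by
  have hx : x ∈ Submodule.span ℂ (Set.range (TensorPow.tprod (n := n))) := by
    rw [TensorPow.span_tprod]; trivial
  have hy : y ∈ Submodule.span ℂ (Set.range (TensorPow.tprod (n := n))) := by
    rw [TensorPow.span_tprod]; trivial
  induction hx using Submodule.span_induction with
  | mem x h =>
    obtain ⟨a, rfl⟩ := h
    induction hy using Submodule.span_induction with
    | mem y h =>
      obtain ⟨b, rfl⟩ := h
      simp [TensorPow.congr_tprod, TensorPow.inner_tprod]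
    | zero => simp
    | add y z _ _ h1 h2 => simp [h1, h2]
    | smul c y _ h => simp [h]
  | zero => simp
  | add y z _ _ h1 h2 => simp [h1, h2]
  | smul c y _ h => simp [h]

/-- The unitary operator `e ⊗ ⋯ ⊗ e` on `(ℂ²)^{⊗ n}` for a unitary operator `e` on `ℂ²`. -/
def TensorPow.map (n : ℕ) : (C2 ≃ₗᵢ[ℂ] C2) →* (TensorPow n ≃ₗᵢ[ℂ] TensorPow n) where
  toFun e := (TensorPow.congr n e.toLinearEquiv).isometryOfInner (TensorPow.inner_congr e)
  map_one' := by
    ext x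
    exact congrArg (fun f : (⨂[ℂ] _ : Fin n, C2) →ₗ[ℂ] (⨂[ℂ] _ : Fin n, C2) => f x)
      (PiTensorProduct.map_id (R := ℂ) (s := fun _ : Fin n => C2))
  map_mul' e f := by
    ext x
    exact congrArg (fun f : (⨂[ℂ] _ : Fin n, C2) →ₗ[ℂ] (⨂[ℂ] _ : Fin n, C2) => f x)
      (PiTensorProduct.map_comp (fun _ : Fin n => e.toLinearEquiv.toLinearMap)
        (fun _ : Fin n => f.toLinearEquiv.toLinearMap))

theorem TensorPow.map_tprod {n : ℕ} (e : C2 ≃ₗᵢ[ℂ] C2) (x : Fin n → C2) :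
    TensorPow.map n e (TensorPow.tprod x) = TensorPow.tprod fun i => e (x i) :=
  TensorPow.congr_tprod e.toLinearEquiv x

/-- The action of a permutation on `(ℂ²)^{⊗ n}`,
`x₁ ⊗ ⋯ ⊗ xₙ ↦ x_{σ⁻¹ 1} ⊗ ⋯ ⊗ x_{σ⁻¹ n}`. -/
def TensorPow.perm {n : ℕ} (σ : Equiv.Perm (Fin n)) : TensorPow n ≃ₗ[ℂ] TensorPow n :=
  (PiTensorProduct.reindex ℂ (fun _ : Fin n => C2) σ :
    (⨂[ℂ] _ : Fin n, C2) ≃ₗ[ℂ] (⨂[ℂ] _ : Fin n, C2))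

theorem TensorPow.perm_tprod {n : ℕ} (σ : Equiv.Perm (Fin n)) (x : Fin n → C2) :
    TensorPow.perm σ (TensorPow.tprod x) = TensorPow.tprod fun i => x (σ.symm i) :=
  PiTensorProduct.reindex_tprod σ x

/-! ### The irreducible representations `ρ_n` of `SU(2)` on the symmetric tensors `L_n` -/

/-- The symmetric tensors in `(ℂ²)^{⊗ n}`. -/
def symTensors (n : ℕ) : Submodule ℂ (TensorPow n) where
  carrier := {x | ∀ σ : Equiv.Perm (Fin n), TensorPow.perm σ x = x}
  add_mem' hx hy σ := by rw [map_add, hx σ, hy σ]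
  zero_mem' σ := map_zero _
  smul_mem' c x hx σ := by rw [map_smul, hx σ]

/-- The Hilbert space `L_n` of symmetric tensors of degree `n`, with the inner product
of `(ℂ²)^{⊗ n}`. -/
def L (n : ℕ) : Type := symTensors n

instance (n : ℕ) : NormedAddCommGroup (L n) := inferInstanceAs (NormedAddCommGroup (symTensors n))

instance (n : ℕ) : InnerProductSpace ℂ (L n) :=
  inferInstanceAs (InnerProductSpace ℂ (symTensors n))

/-- The inclusion of `L_n` in `(ℂ²)^{⊗ n}`. -/
def L.incl (n : ℕ) : L n →ₗᵢ[ℂ] TensorPow n := (symTensors n).subtypeₗᵢ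

theorem L.range_incl (n : ℕ) : LinearMap.range (L.incl n).toLinearMap = symTensors n :=
  (symTensors n).range_subtype

theorem map_mem_symTensors {n : ℕ} (e : C2 ≃ₗᵢ[ℂ] C2) {x : TensorPow n} (hx : x ∈ symTensors n) :
    TensorPow.map n e x ∈ symTensors n := by
  intro σ
  have h : TensorPow.map n e (TensorPow.perm σ x) = TensorPow.perm σ (TensorPow.map n e x) :=
    PiTensorProduct.map_reindex (fun _ : Fin n => e.toLinearEquiv.toLinearMap) σ x
  rw [← h, hx σ]

/-- The restriction of a unitary representation to an invariant subspace. -/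
def restrictRep {G E : Type*} [Group G] [NormedAddCommGroup E] [InnerProductSpace ℂ E]
    (U : G →* (E ≃ₗᵢ[ℂ] E)) (S : Submodule ℂ E) (hS : ∀ g, ∀ x ∈ S, U g x ∈ S) :
    G →* (S ≃ₗᵢ[ℂ] S) where
  toFun g :=
    { toFun := fun x => ⟨U g x, hS g x x.2⟩
      invFun := fun x => ⟨U g⁻¹ x, hS g⁻¹ x x.2⟩
      left_inv := fun x => by ext; simp
      right_inv := fun x => by ext; simp
      map_add' := fun x y => by ext; simp
      map_smul' := fun c x => by ext; simp
      norm_map' := fun x => (U g).norm_map x }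
  map_one' := by ext x; simp
  map_mul' g h := by ext x; simp

/-- The fundamental representation of `SU(2)` on `ℂ²`, by matrix multiplication. -/
def fundRep : SU2 →* (C2 ≃ₗᵢ[ℂ] C2) :=
  (Unitary.linearIsometryEquiv (𝕜 := ℂ) (H := C2)).toMonoidHom.comp
    { toFun := fun g => ⟨Matrix.toEuclideanCLM (n := Fin 2) (𝕜 := ℂ) g,
        Unitary.map_mem _ (Matrix.specialUnitaryGroup_le_unitaryGroup g.2)⟩
      map_one' := by ext1; simp
      map_mul' := fun g h => by ext1; simp }

theorem fundRep_apply (g : SU2) (x : C2) (i : Fin 2) :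
    fundRep g x i = ∑ j, (g : Matrix (Fin 2) (Fin 2) ℂ) i j * x j := by
  change Matrix.toEuclideanCLM (n := Fin 2) (𝕜 := ℂ) g x i = _
  simp [Matrix.mulVec, dotProduct]

/-- The representation `ρ_n` of `SU(2)` on `L_n`, the restriction of the `n`-fold tensor power of
the fundamental representation. -/
def rho (n : ℕ) : SU2 →* (L n ≃ₗᵢ[ℂ] L n) :=
  (restrictRep ((TensorPow.map n).comp fundRep) (symTensors n)
    fun g _ hx => map_mem_symTensors (fundRep g) hx :
    SU2 →* (symTensors n ≃ₗᵢ[ℂ] symTensors n))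

theorem incl_rho (n : ℕ) (g : SU2) (x : L n) :
    L.incl n (rho n g x) = TensorPow.map n (fundRep g) (L.incl n x) := rfl

/-! ### The determinant of a representation -/

/-- The determinant `det(τ, H)`: the subspace of `H ⊗ H` of vectors invariant under
`τ(g) ⊗ τ(g)` for all `g ∈ SU(2)`. -/
def det {H : Type*} [NormedAddCommGroup H] [InnerProductSpace ℂ H]
    (τ : SU2 →* (H ≃ₗᵢ[ℂ] H)) : Submodule ℂ (H ⊗[ℂ] H) where
  carrier := {ξ | ∀ g : SU2, TensorProduct.congrIsometry (τ g) (τ g) ξ = ξ}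
  add_mem' hx hy g := by rw [map_add, hx g, hy g]
  zero_mem' g := map_zero _
  smul_mem' c x hx g := by rw [map_smul, hx g]

/-! ### Hilbert space direct sums -/

theorem memℓp_map {E F : ℕ → Type*}
    [∀ m, NormedAddCommGroup (E m)] [∀ m, InnerProductSpace ℂ (E m)]
    [∀ m, NormedAddCommGroup (F m)] [∀ m, InnerProductSpace ℂ (F m)]
    (e : ∀ m, E m ≃ₗᵢ[ℂ] F m) (x : lp E 2) : Memℓp (fun m => e m (x m)) 2 :=
  (lp.memℓp x).mono' fun m => ((e m).norm_map (x m)).le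

/-- The direct sum of a sequence of unitary operators. -/
def lpCongr {E F : ℕ → Type*}
    [∀ m, NormedAddCommGroup (E m)] [∀ m, InnerProductSpace ℂ (E m)]
    [∀ m, NormedAddCommGroup (F m)] [∀ m, InnerProductSpace ℂ (F m)]
    (e : ∀ m, E m ≃ₗᵢ[ℂ] F m) : lp E 2 ≃ₗᵢ[ℂ] lp F 2 where
  toFun x := ⟨fun m => e m (x m), memℓp_map e x⟩
  invFun x := ⟨fun m => (e m).symm (x m), memℓp_map (fun m => (e m).symm) x⟩
  left_inv x := by ext m; exact (e m).symm_apply_apply (x m)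
  right_inv x := by ext m; exact (e m).apply_symm_apply (x m)
  map_add' x y := by ext m; exact (e m).map_add (x m) (y m)
  map_smul' c x := by ext m; exact (e m).map_smul c (x m)
  norm_map' x := by
    have h : 0 < (2 : ENNReal).toReal := by norm_num
    rw [lp.norm_eq_tsum_rpow h, lp.norm_eq_tsum_rpow h]
    congr 2
    funext m
    exact congrArg (· ^ _) ((e m).norm_map (x m))

theorem lpCongr_apply {E F : ℕ → Type*}
    [∀ m, NormedAddCommGroup (E m)] [∀ m, InnerProductSpace ℂ (E m)]
    [∀ m, NormedAddCommGroup (F m)] [∀ m, InnerProductSpace ℂ (F m)]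
    (e : ∀ m, E m ≃ₗᵢ[ℂ] F m) (x : lp E 2) (m : ℕ) : lpCongr e x m = e m (x m) := rfl

/-- The inclusion `x ↦ x δ_m` of the `m`-th summand in a Hilbert space direct sum. -/
def lpSingle {E : ℕ → Type*} [∀ m, NormedAddCommGroup (E m)] [∀ m, InnerProductSpace ℂ (E m)]
    (m : ℕ) : E m →ₗᵢ[ℂ] lp E 2 where
  toLinearMap := lp.lsingle 2 m
  norm_map' x := lp.norm_single (by norm_num) m x

/-- `E^{⊕ κ}`, the orthogonal direct sum of copies of `E` indexed by `κ`. -/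
abbrev Copies (κ : Type*) (E : Type*) : Type _ := PiLp 2 fun _ : κ => E

/-- `⨁_m L_m^{⊕ k_m}`. -/
abbrev IsotypicSum (k : ℕ → ℕ) : Type := lp (fun m => Copies (Fin (k m)) (L m)) 2

/-- The representation `⨁_m ρ_m^{⊕ k_m}` on `⨁_m L_m^{⊕ k_m}`. -/
def isotypicRep (k : ℕ → ℕ) : SU2 →* (IsotypicSum k ≃ₗᵢ[ℂ] IsotypicSum k) where
  toFun g := lpCongr fun m => LinearIsometryEquiv.piLpCongrRight 2 fun _ : Fin (k m) => rho m g
  map_one' := by ext x m i; simp [lpCongr_apply]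
  map_mul' g h := by ext x m i; simp [lpCongr_apply]

theorem isotypicRep_apply (k : ℕ → ℕ) (g : SU2) (x : IsotypicSum k) (m : ℕ) (i : Fin (k m)) :
    isotypicRep k g x m i = rho m g (x m i) := rfl

/-- `⨁_m (L_m ⊗ L_m)^{⊕ k_m²}`, where the `k_m²` copies are indexed by pairs. -/
abbrev SquareSum (k : ℕ → ℕ) : Type :=
  lp (fun m => Copies (Fin (k m) × Fin (k m)) (L m ⊗[ℂ] L m)) 2

/-- The subspace `⨁_m det(ρ_m, L_m)^{⊕ k_m²}` of `⨁_m (L_m ⊗ L_m)^{⊕ k_m²}`. -/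
def detSum (k : ℕ → ℕ) : Submodule ℂ (SquareSum k) where
  carrier := {x | ∀ (m : ℕ) (p : Fin (k m) × Fin (k m)), x m p ∈ det (rho m)}
  add_mem' hx hy m p := (det (rho m)).add_mem (hx m p) (hy m p)
  zero_mem' m _ := (det (rho m)).zero_mem
  smul_mem' c _ hx m p := (det (rho m)).smul_mem c (hx m p)

theorem sum_single {κ E : Type*} [Fintype κ] [DecidableEq κ] [NormedAddCommGroup E] (x : Copies κ E) :
    ∑ i, (PiLp.single 2 i (x i) : Copies κ E) = x := by
  ext j
  simp [Finset.sum_apply, Pi.single_apply]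

section Isometries

variable {E F G H E' F' : Type*}
  [NormedAddCommGroup E] [InnerProductSpace ℂ E] [NormedAddCommGroup F] [InnerProductSpace ℂ F]
  [NormedAddCommGroup E'] [InnerProductSpace ℂ E'] [NormedAddCommGroup F'] [InnerProductSpace ℂ F']
  [NormedAddCommGroup G] [InnerProductSpace ℂ G] [NormedAddCommGroup H] [InnerProductSpace ℂ H]

theorem inner_map_map_eq_zero (f : E →ₗᵢ[ℂ] G) (f' : E' →ₗᵢ[ℂ] G) (g : F →ₗᵢ[ℂ] H)
    (g' : F' →ₗᵢ[ℂ] H)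
    (h : (∀ a b, ⟪f a, f' b⟫_ℂ = 0) ∨ (∀ a b, ⟪g a, g' b⟫_ℂ = 0))
    (x : E ⊗[ℂ] F) (y : E' ⊗[ℂ] F') :
    ⟪TensorProduct.mapIsometry f g x, TensorProduct.mapIsometry f' g' y⟫_ℂ = 0 := by
  induction x with
  | zero => simp
  | add a b ha hb => rw [map_add, inner_add_left, ha, hb, add_zero]
  | tmul a b =>
    induction y with
    | zero => simp
    | add a b ha hb => rw [map_add, inner_add_right, ha, hb, add_zero]
    | tmul c d => rcases h with h | h <;> simp [h]

/-- The inclusion of the `i`-th summand in `E^{⊕ κ}`. -/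
def copiesSingle {κ : Type*} [Fintype κ] [DecidableEq κ] (i : κ) : E →ₗᵢ[ℂ] Copies κ E where
  toFun x := PiLp.single 2 i x
  map_add' x y := by ext j; by_cases h : j = i <;> simp [h]
  map_smul' c x := by ext j; by_cases h : j = i <;> simp [h]
  norm_map' x := by simp

theorem copiesSingle_apply {κ : Type*} [Fintype κ] [DecidableEq κ] (i : κ) (x : E) :
    copiesSingle i x = PiLp.single 2 i x := rfl

theorem inner_copiesSingle {κ : Type*} [Fintype κ] [DecidableEq κ] {i j : κ} (h : i ≠ j)
    (x y : E) : ⟪copiesSingle i x, copiesSingle j y⟫_ℂ = 0 := by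
  rw [PiLp.inner_apply]
  refine Finset.sum_eq_zero fun l _ => ?_
  by_cases hl : l = i
  · subst hl; simp [copiesSingle_apply, h]
  · simp [copiesSingle_apply, hl]

/-- The linear map underlying `copiesTensor`. -/
def copiesTensorMap (κ : Type*) [Fintype κ] [DecidableEq κ] (E : Type*) [NormedAddCommGroup E]
    [InnerProductSpace ℂ E] :
    Copies (κ × κ) (E ⊗[ℂ] E) →ₗ[ℂ] Copies κ E ⊗[ℂ] Copies κ E where
  toFun x := ∑ p : κ × κ, TensorProduct.mapIsometry (copiesSingle p.1) (copiesSingle p.2) (x p)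
  map_add' x y := by simp [Finset.sum_add_distrib]
  map_smul' c x := by simp [Finset.smul_sum]

theorem copiesTensorMap_single {κ : Type*} [Fintype κ] [DecidableEq κ] (i j : κ) (ξ η : E) :
    copiesTensorMap κ E (PiLp.single 2 (i, j) (ξ ⊗ₜ[ℂ] η))
      = PiLp.single 2 i ξ ⊗ₜ[ℂ] PiLp.single 2 j η := by
  change ∑ p : κ × κ, TensorProduct.mapIsometry (copiesSingle p.1) (copiesSingle p.2)
    ((PiLp.single 2 (i, j) (ξ ⊗ₜ[ℂ] η) : Copies (κ × κ) (E ⊗[ℂ] E)) p) = _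
  rw [Finset.sum_eq_single (i, j)]
  · simp [copiesSingle_apply]
  · intro p _ hp
    simp [hp]
  · simp

theorem inner_copiesTensorMap {κ : Type*} [Fintype κ] [DecidableEq κ]
    (x y : Copies (κ × κ) (E ⊗[ℂ] E)) :
    ⟪copiesTensorMap κ E x, copiesTensorMap κ E y⟫_ℂ = ⟪x, y⟫_ℂ := by
  change ⟪∑ p : κ × κ, TensorProduct.mapIsometry (copiesSingle p.1) (copiesSingle p.2) (x p),
    ∑ p : κ × κ, TensorProduct.mapIsometry (copiesSingle p.1) (copiesSingle p.2) (y p)⟫_ℂ = _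
  rw [sum_inner, PiLp.inner_apply]
  refine Finset.sum_congr rfl fun p _ => ?_
  rw [inner_sum, Finset.sum_eq_single p]
  · exact LinearIsometry.inner_map_map _ _ _
  · intro q _ hq
    refine inner_map_map_eq_zero _ _ _ _ ?_ _ _
    by_cases h : p.1 = q.1
    · right
      exact inner_copiesSingle fun h' => hq (Prod.ext h h').symm
    · left
      exact inner_copiesSingle h
  · simp

theorem copiesTensorMap_surjective (κ : Type*) [Fintype κ] [DecidableEq κ] (E : Type*)
    [NormedAddCommGroup E] [InnerProductSpace ℂ E] :
    Function.Surjective (copiesTensorMap κ E) := by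
  intro z
  induction z with
  | zero => exact ⟨0, map_zero _⟩
  | add a b ha hb =>
    obtain ⟨x, rfl⟩ := ha
    obtain ⟨y, rfl⟩ := hb
    exact ⟨x + y, map_add _ _ _⟩
  | tmul a b =>
    refine ⟨∑ i, ∑ j, PiLp.single 2 (i, j) (a i ⊗ₜ[ℂ] b j), ?_⟩
    simp only [map_sum, copiesTensorMap_single]
    conv_rhs => rw [← sum_single a, ← sum_single b]
    simp only [TensorProduct.sum_tmul, TensorProduct.tmul_sum]
    exact Finset.sum_comm

/-- The canonical unitary operator `(E ⊗ E)^{⊕ κ × κ} ≅ E^{⊕ κ} ⊗ E^{⊕ κ}`; it sends `ξ ⊗ η` in the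
summand `(i, j)` to the tensor product of `ξ` in the summand `i` and `η` in the summand `j`. -/
def copiesTensor (κ : Type*) [Fintype κ] [DecidableEq κ] (E : Type*) [NormedAddCommGroup E]
    [InnerProductSpace ℂ E] :
    Copies (κ × κ) (E ⊗[ℂ] E) ≃ₗᵢ[ℂ] Copies κ E ⊗[ℂ] Copies κ E :=
  (LinearEquiv.ofBijective (copiesTensorMap κ E)
    ⟨((copiesTensorMap κ E).isometryOfInner inner_copiesTensorMap).injective,
      copiesTensorMap_surjective κ E⟩).isometryOfInner inner_copiesTensorMap

theorem copiesTensor_single {κ : Type*} [Fintype κ] [DecidableEq κ] (i j : κ) (ξ η : E) :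
    copiesTensor κ E (PiLp.single 2 (i, j) (ξ ⊗ₜ[ℂ] η))
      = PiLp.single 2 i ξ ⊗ₜ[ℂ] PiLp.single 2 j η :=
  copiesTensorMap_single i j ξ η

end Isometries

/-- The canonical unitary operator
`⨁_m (L_m ⊗ L_m)^{⊕ k_m²} ≅ ⨁_m (L_m^{⊕ k_m} ⊗ L_m^{⊕ k_m})`. -/
def squareSumEquiv (k : ℕ → ℕ) :
    SquareSum k ≃ₗᵢ[ℂ] lp (fun m => Copies (Fin (k m)) (L m) ⊗[ℂ] Copies (Fin (k m)) (L m)) 2 :=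
  lpCongr fun m => copiesTensor (Fin (k m)) (L m)

section Iota

variable {H : Type*} [NormedAddCommGroup H] [InnerProductSpace ℂ H]

/-- The isometry `ξ ↦ V (ξ δ_m)` from `L_m^{⊕ k_m}` to `H`. -/
def summand {k : ℕ → ℕ} (V : IsotypicSum k ≃ₗᵢ[ℂ] H) (m : ℕ) :
    Copies (Fin (k m)) (L m) →ₗᵢ[ℂ] H :=
  V.toLinearIsometry.comp (lpSingle (E := fun m => Copies (Fin (k m)) (L m)) m)

theorem summand_apply {k : ℕ → ℕ} (V : IsotypicSum k ≃ₗᵢ[ℂ] H) (m : ℕ)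
    (ξ : Copies (Fin (k m)) (L m)) :
    summand V m ξ = V (lp.single (E := fun m => Copies (Fin (k m)) (L m)) 2 m ξ) := rfl

theorem inner_summand {k : ℕ → ℕ} (V : IsotypicSum k ≃ₗᵢ[ℂ] H) {m l : ℕ} (h : m ≠ l)
    (ξ : Copies (Fin (k m)) (L m)) (η : Copies (Fin (k l)) (L l)) :
    ⟪summand V m ξ, summand V l η⟫_ℂ = 0 := by
  rw [summand_apply, summand_apply, V.inner_map_map, lp.inner_single_left,
    lp.single_apply_ne _ _ _ h, inner_zero_right]

theorem orthogonalFamily_summand {k : ℕ → ℕ} (V : IsotypicSum k ≃ₗᵢ[ℂ] H) :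
    OrthogonalFamily ℂ (fun m => Copies (Fin (k m)) (L m) ⊗[ℂ] Copies (Fin (k m)) (L m))
      fun m => TensorProduct.mapIsometry (summand V m) (summand V m) :=
  fun _ _ h => inner_map_map_eq_zero _ _ _ _ (Or.inl (inner_summand V h))

variable [FiniteDimensional ℂ H]

instance : CompleteSpace (H ⊗[ℂ] H) := FiniteDimensional.complete ℂ _

/-- The isometry `ι : ⨁_m (L_m^{⊕ k_m} ⊗ L_m^{⊕ k_m}) → H ⊗ H`, given in degree `m` by
`ι (ξ ⊗ η) = V (ξ δ_m) ⊗ V (η δ_m)`; see `iota_single`. -/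
def iota {k : ℕ → ℕ} (V : IsotypicSum k ≃ₗᵢ[ℂ] H) :
    lp (fun m => Copies (Fin (k m)) (L m) ⊗[ℂ] Copies (Fin (k m)) (L m)) 2 →ₗᵢ[ℂ] H ⊗[ℂ] H :=
  (orthogonalFamily_summand V).linearIsometry

theorem iota_single {k : ℕ → ℕ} (V : IsotypicSum k ≃ₗᵢ[ℂ] H) (m : ℕ)
    (ξ η : Copies (Fin (k m)) (L m)) :
    iota V (lp.single 2 m (ξ ⊗ₜ[ℂ] η))
      = V (lp.single (E := fun m => Copies (Fin (k m)) (L m)) 2 m ξ) ⊗ₜ[ℂ]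
        V (lp.single (E := fun m => Copies (Fin (k m)) (L m)) 2 m η) := by
  rw [iota, OrthogonalFamily.linearIsometry_apply_single]
  rfl

end Iota

end SU2Det

end

/-!
Schur's lemma is made explicit through highest weights. The powers `v ⊗ ⋯ ⊗ v` span `L_n`, and up
to scalars they form one `SU(2)`-orbit, so an invariant `ξ ∈ L_m ⊗ F` is determined by its
contraction `f ∈ F` with `e₀ ⊗ ⋯ ⊗ e₀`, and `f` is a vector of torus weight `-m`. For `F = L_n`
there is no such vector `f ≠ 0` if `n < m`, and it is a multiple of `e₁ ⊗ ⋯ ⊗ e₁` if `n = m`. Hence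
`L_m ⊗ L_n` has no invariants for `m ≠ n`, while those of `L_n ⊗ L_n` form the line through the
singlet, the vector representing the `n`-th tensor power of the area form. Compressing an invariant
of `H ⊗ H` to the copies of the `L_m` in `H` then shows that it is a combination of the orthogonal
singlets of the pairs of copies of the same `L_m`.
-/

noncomputable section

namespace SU2Det

/-! ### Symmetric powers of vectors -/

section

variable {n : ℕ}

instance : FiniteDimensional ℂ (TensorPow n) :=
  (TensorPow.basis n).finiteDimensional_of_finite

instance : FiniteDimensional ℂ (L n) :=
  inferInstanceAs (FiniteDimensional ℂ (symTensors n))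

theorem TensorPow.linearMap_ext {F : Type*} [AddCommGroup F] [Module ℂ F]
    {f g : TensorPow n →ₗ[ℂ] F} (h : ∀ x, f (TensorPow.tprod x) = g (TensorPow.tprod x)) :
    f = g :=
  LinearMap.ext_on_range (TensorPow.span_tprod n) h

theorem TensorPow.coord_basis (p : Fin n → Fin 2) (x : TensorPow n) :
    (TensorPow.basis n).coord p x = TensorPow.coords n x p := rfl

theorem TensorPow.coords_perm (σ : Equiv.Perm (Fin n)) (x : TensorPow n) (p : Fin n → Fin 2) :
    TensorPow.coords n (TensorPow.perm σ x) p = TensorPow.coords n x (p ∘ σ) := by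
  have h : (TensorPow.basis n).coord p ∘ₗ (TensorPow.perm σ).toLinearMap
      = (TensorPow.basis n).coord (p ∘ σ) := by
    refine TensorPow.linearMap_ext fun y => ?_
    simp only [LinearMap.comp_apply, LinearEquiv.coe_coe, TensorPow.coord_basis,
      TensorPow.perm_tprod, TensorPow.coords_tprod]
    exact Fintype.prod_equiv σ.symm _ _ fun i => by simp
  exact LinearMap.congr_fun h x

theorem TensorPow.coords_map_of_diagonal {e : C2 ≃ₗᵢ[ℂ] C2} {d : Fin 2 → ℂ}
    (he : ∀ v j, e v j = d j * v j) (x : TensorPow n) (p : Fin n → Fin 2) :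
    TensorPow.coords n (TensorPow.map n e x) p = (∏ i, d (p i)) * TensorPow.coords n x p := by
  have h : (TensorPow.basis n).coord p ∘ₗ (TensorPow.map n e).toLinearEquiv.toLinearMap
      = (∏ i, d (p i)) • (TensorPow.basis n).coord p := by
    refine TensorPow.linearMap_ext fun y => ?_
    simp only [LinearMap.comp_apply, LinearMap.smul_apply, LinearEquiv.coe_coe,
      LinearIsometryEquiv.coe_toLinearEquiv, TensorPow.coord_basis, TensorPow.map_tprod,
      TensorPow.coords_tprod, he, Finset.prod_mul_distrib, smul_eq_mul]
  exact LinearMap.congr_fun h x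

theorem L.ext_coords {x y : L n}
    (h : ∀ p, TensorPow.coords n (L.incl n x) p = TensorPow.coords n (L.incl n y) p) : x = y :=
  (L.incl n).injective <| (TensorPow.coords n).injective <| by ext p; exact h p

theorem exists_perm_comp_eq_of_card_fiber_eq {ι α : Type*} [Fintype ι] [DecidableEq α]
    {p q : ι → α} (h : ∀ a, Fintype.card {i // p i = a} = Fintype.card {i // q i = a}) :
    ∃ σ : Equiv.Perm ι, q ∘ σ = p :=
  ⟨Equiv.ofFiberEquiv fun a => Fintype.equivOfCardEq (h a),
    funext fun i => Equiv.ofFiberEquiv_map _ i⟩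

/-- The number of factors `f₁` in the basis tensor `f_{p 1} ⊗ ⋯ ⊗ f_{p n}`. -/
def weight (p : Fin n → Fin 2) : ℕ := Fintype.card {i // p i = 1}

theorem card_fiber_zero (p : Fin n → Fin 2) : Fintype.card {i // p i = 0} = n - weight p := by
  rw [Fintype.card_congr (Equiv.subtypeEquivRight fun i => (by omega : p i = 0 ↔ ¬ p i = 1)),
    Fintype.card_subtype_compl, Fintype.card_fin, weight]

theorem weight_le (p : Fin n → Fin 2) : weight p ≤ n :=
  (Fintype.card_subtype_le _).trans_eq (Fintype.card_fin n)

theorem prod_comp_eq_pow_weight {M : Type*} [CommMonoid M] (d : Fin 2 → M) (p : Fin n → Fin 2) :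
    ∏ i, d (p i) = d 0 ^ (n - weight p) * d 1 ^ weight p := by
  rw [← Finset.prod_fiberwise' Finset.univ p d, Fin.prod_univ_two, Finset.prod_const,
    Finset.prod_const, ← Fintype.card_subtype, ← Fintype.card_subtype, card_fiber_zero, weight]

theorem eq_one_of_weight_eq {p : Fin n → Fin 2} (hp : weight p = n) : p = 1 := by
  have h0 : Fintype.card {i // p i = 0} = 0 := by rw [card_fiber_zero, hp, Nat.sub_self]
  have hempty := Fintype.card_eq_zero_iff.mp h0
  funext i
  have hi : p i ≠ 0 := fun h => hempty.elim ⟨i, h⟩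
  exact Fin.eq_one_of_ne_zero _ hi

theorem L.coords_eq_of_weight_eq (x : L n) {p q : Fin n → Fin 2} (h : weight p = weight q) :
    TensorPow.coords n (L.incl n x) p = TensorPow.coords n (L.incl n x) q := by
  obtain ⟨σ, rfl⟩ : ∃ σ : Equiv.Perm (Fin n), q ∘ σ = p := by
    refine exists_perm_comp_eq_of_card_fiber_eq (Fin.forall_fin_two.mpr ⟨?_, h⟩)
    rw [card_fiber_zero, card_fiber_zero, h]
  rw [← TensorPow.coords_perm, show TensorPow.perm σ (L.incl n x) = L.incl n x from x.2 σ]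

/-- The symmetric tensor `v ⊗ ⋯ ⊗ v`. -/
def L.pow (n : ℕ) (v : C2) : L n :=
  (⟨TensorPow.tprod fun _ => v, fun σ => TensorPow.perm_tprod σ _⟩ : symTensors n)

theorem L.incl_pow (v : C2) : L.incl n (L.pow n v) = TensorPow.tprod fun _ => v := rfl

theorem L.coords_pow (v : C2) (p : Fin n → Fin 2) :
    TensorPow.coords n (L.incl n (L.pow n v)) p = v 0 ^ (n - weight p) * v 1 ^ weight p := by
  rw [L.incl_pow, TensorPow.coords_tprod, prod_comp_eq_pow_weight]

theorem L.pow_smul (c : ℂ) (v : C2) : L.pow n (c • v) = c ^ n • L.pow n v := by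
  refine L.ext_coords fun p => ?_
  simp [L.incl_pow, TensorPow.coords_tprod, Finset.prod_mul_distrib]

theorem rho_pow (g : SU2) (v : C2) : rho n g (L.pow n v) = L.pow n (fundRep g v) :=
  (L.incl n).injective (by rw [incl_rho, L.incl_pow, L.incl_pow, TensorPow.map_tprod])

theorem sum_filter_eq_zero_of_forall_sum_mul_pow {R ι : Type*} [CommRing R] [IsDomain R]
    [Infinite R] {s : Finset ι} {a : ι → R} {w : ι → ℕ}
    (h : ∀ t : R, ∑ i ∈ s, a i * t ^ w i = 0) (j : ℕ) : ∑ i ∈ s with w i = j, a i = 0 := by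
  have hP : ∑ i ∈ s, Polynomial.monomial (w i) (a i) = 0 :=
    Polynomial.funext fun t => by
      simpa [Polynomial.eval_finsetSum, Polynomial.eval_monomial] using h t
  simpa [Polynomial.finsetSum_coeff, Polynomial.coeff_monomial, Finset.sum_filter]
    using congrArg (Polynomial.coeff · j) hP

theorem L.span_pow : Submodule.span ℂ (Set.range (L.pow n)) = ⊤ := by
  rw [← Submodule.orthogonal_eq_bot_iff, Submodule.eq_bot_iff]
  intro x hx
  have hsum (t : ℂ) :
      ∑ p, star (TensorPow.coords n (L.incl n x) p) * t ^ weight p = 0 := by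
    have h := (Submodule.mem_orthogonal' _ _).mp hx _ (Submodule.subset_span ⟨!₂[1, t], rfl⟩)
    rw [← (L.incl n).inner_map_map, TensorPow.inner_def, PiLp.inner_apply] at h
    simpa [L.coords_pow, mul_comm] using h
  refine L.ext_coords fun q => ?_
  have hq := sum_filter_eq_zero_of_forall_sum_mul_pow hsum (weight q)
  rw [Finset.sum_congr rfl fun p hp => by
      rw [x.coords_eq_of_weight_eq (Finset.mem_filter.mp hp).2],
    Finset.sum_const, smul_eq_zero] at hq
  simpa using hq.resolve_left (Finset.card_ne_zero_of_mem (a := q) (by simp))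

end

/-! ### Invariants in tensor products -/

section

variable {𝕜 G E F E' F' : Type*} [RCLike 𝕜] [Group G]
  [NormedAddCommGroup E] [InnerProductSpace 𝕜 E] [NormedAddCommGroup F] [InnerProductSpace 𝕜 F]
  [NormedAddCommGroup E'] [InnerProductSpace 𝕜 E'] [NormedAddCommGroup F'] [InnerProductSpace 𝕜 F']
  {π : G →* (E ≃ₗᵢ[𝕜] E)} {σ : G →* (F ≃ₗᵢ[𝕜] F)}
  {π' : G →* (E' ≃ₗᵢ[𝕜] E')} {σ' : G →* (F' ≃ₗᵢ[𝕜] F')}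

variable (π σ) in
/-- The subspace of `E ⊗ F` of vectors invariant under `π g ⊗ σ g` for all `g`; `det τ` is the case
`π = σ = τ`. -/
def invariantTensors : Submodule 𝕜 (E ⊗[𝕜] F) where
  carrier := {ξ | ∀ g, TensorProduct.congrIsometry (π g) (σ g) ξ = ξ}
  add_mem' hx hy g := by rw [map_add, hx g, hy g]
  zero_mem' g := map_zero _
  smul_mem' c x hx g := by rw [map_smul, hx g]

theorem map_mem_invariantTensors {f : E →ₗ[𝕜] E'} {f' : F →ₗ[𝕜] F'}
    (hf : ∀ g x, f (π g x) = π' g (f x)) (hf' : ∀ g x, f' (σ g x) = σ' g (f' x))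
    {ξ : E ⊗[𝕜] F} (hξ : ξ ∈ invariantTensors π σ) :
    TensorProduct.map f f' ξ ∈ invariantTensors π' σ' := by
  intro g
  have hcomm (ω : E ⊗[𝕜] F) : TensorProduct.congrIsometry (π' g) (σ' g) (TensorProduct.map f f' ω)
      = TensorProduct.map f f' (TensorProduct.congrIsometry (π g) (σ g) ω) := by
    induction ω with
    | zero => simp only [map_zero]
    | add a b ha hb => simp only [map_add, ha, hb]
    | tmul a b => simp [hf, hf']
  rw [hcomm, hξ g]

theorem comm_mem_invariantTensors {ξ : E ⊗[𝕜] F} (hξ : ξ ∈ invariantTensors π σ) :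
    TensorProduct.comm 𝕜 E F ξ ∈ invariantTensors σ π := by
  intro g
  have hcomm (ω : E ⊗[𝕜] F) :
      TensorProduct.congrIsometry (σ g) (π g) (TensorProduct.comm 𝕜 E F ω)
        = TensorProduct.comm 𝕜 E F (TensorProduct.congrIsometry (π g) (σ g) ω) := by
    induction ω with
    | zero => simp only [map_zero]
    | add a b ha hb => simp only [map_add, ha, hb]
    | tmul a b => simp
  rw [hcomm, hξ g]

theorem inner_apply_eq_inner_inv_apply (π : G →* (E ≃ₗᵢ[𝕜] E)) (g : G) (x y : E) :
    ⟪π g x, y⟫_𝕜 = ⟪x, π g⁻¹ y⟫_𝕜 := by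
  rw [map_inv]
  exact (π g).inner_map_eq_flip x y

theorem adjoint_apply_of_intertwining [FiniteDimensional 𝕜 E] [FiniteDimensional 𝕜 F]
    {f : E →ₗ[𝕜] F} (hf : ∀ g x, f (π g x) = σ g (f x)) (g : G) (y : F) :
    f.adjoint (σ g y) = π g (f.adjoint y) := by
  refine ext_inner_right 𝕜 fun x => ?_
  rw [LinearMap.adjoint_inner_left, inner_apply_eq_inner_inv_apply,
    inner_apply_eq_inner_inv_apply, LinearMap.adjoint_inner_left, hf]

theorem mem_invariantTensors_of_inner_tmul {ξ : E ⊗[𝕜] F}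
    (h : ∀ g x y, ⟪ξ, π g x ⊗ₜ[𝕜] σ g y⟫_𝕜 = ⟪ξ, x ⊗ₜ[𝕜] y⟫_𝕜) : ξ ∈ invariantTensors π σ := by
  intro g
  rw [TensorProduct.ext_iff_inner_right]
  intro x y
  rw [← h g⁻¹, map_inv, map_inv,
    ← (TensorProduct.congrIsometry (π g) (σ g)).inner_map_map ξ (_ ⊗ₜ[𝕜] _)]
  simp

/-- The contraction `x ⊗ y ↦ ⟪u, x⟫ y` of the first tensor factor with `u`. -/
def contractLeft : E →ₗ⋆[𝕜] E ⊗[𝕜] F →ₗ[𝕜] F where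
  toFun u := (TensorProduct.lid 𝕜 F).toLinearMap ∘ₗ (innerₛₗ 𝕜 u).rTensor F
  map_add' u v := by simp [LinearMap.rTensor_add, LinearMap.comp_add]
  map_smul' c u := by simp [LinearMap.rTensor_smul, LinearMap.comp_smul]

theorem contractLeft_tmul (u x : E) (y : F) :
    contractLeft u (x ⊗ₜ[𝕜] y) = ⟪u, x⟫_𝕜 • y := by
  simp [contractLeft]

theorem inner_contractLeft (u : E) (y : F) (ξ : E ⊗[𝕜] F) :
    ⟪y, contractLeft u ξ⟫_𝕜 = ⟪u ⊗ₜ[𝕜] y, ξ⟫_𝕜 := by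
  induction ξ with
  | zero => simp only [map_zero, inner_zero_right]
  | add a b ha hb => simp only [map_add, inner_add_right, ha, hb]
  | tmul a b => rw [contractLeft_tmul, inner_smul_right, TensorProduct.inner_tmul]

theorem eq_zero_of_contractLeft_eq_zero {s : Set E} (hs : Submodule.span 𝕜 s = ⊤) {ξ : E ⊗[𝕜] F}
    (h : ∀ u ∈ s, contractLeft u ξ = 0) : ξ = 0 := by
  have hzero : contractLeft.flip ξ = 0 := LinearMap.ext_on hs h
  rw [TensorProduct.ext_iff_inner_left]
  intro u y
  rw [← inner_contractLeft, ← LinearMap.flip_apply, hzero, LinearMap.zero_apply]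
  simp only [inner_zero_right]

theorem contractLeft_apply_of_mem_invariantTensors {ξ : E ⊗[𝕜] F}
    (hξ : ξ ∈ invariantTensors π σ) (g : G) (u : E) :
    contractLeft (π g u) ξ = σ g (contractLeft u ξ) := by
  have hcomm (ω : E ⊗[𝕜] F) : contractLeft (π g u) (TensorProduct.congrIsometry (π g) (σ g) ω)
      = σ g (contractLeft u ω) := by
    induction ω with
    | zero => simp only [map_zero]
    | add a b ha hb => simp only [map_add, ha, hb]
    | tmul a b => simp [contractLeft_tmul]
  rw [← hcomm, hξ g]

end

/-! ### The action of `SU(2)` -/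

section

open scoped ComplexConjugate

variable {m n : ℕ}

/-- The element of `SU(2)` with first column `(α, β)`. -/
def suMk (α β : ℂ) (h : α * conj α + β * conj β = 1) : SU2 :=
  ⟨!![α, -conj β; β, conj α], by
    rw [Matrix.mem_specialUnitaryGroup_iff, Matrix.mem_unitaryGroup_iff']
    constructor
    · ext i j
      fin_cases i <;> fin_cases j <;> simp [Matrix.mul_apply, Matrix.star_apply]
      · linear_combination h
      · ring
      · ring
      · linear_combination h
    · rw [Matrix.det_fin_two_of]
      linear_combination h⟩

theorem fundRep_suMk (α β : ℂ) (h : α * conj α + β * conj β = 1) (v : C2) :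
    fundRep (suMk α β h) v = !₂[α * v 0 - conj β * v 1, β * v 0 + conj α * v 1] := by
  ext i
  rw [fundRep_apply]
  fin_cases i <;> simp [suMk, Fin.sum_univ_two, sub_eq_add_neg]

theorem exists_fundRep_eq (u : C2) : ∃ (g : SU2) (a : ℂ), fundRep g (a • !₂[1, 0]) = u := by
  by_cases hu : u = 0
  · exact ⟨1, 0, by simp [hu]⟩
  have hn : (‖u‖ : ℂ) ≠ 0 := by simpa using hu
  have hs : u 0 * conj (u 0) + u 1 * conj (u 1) = (‖u‖ : ℂ) ^ 2 := by
    simp only [Complex.mul_conj, Complex.normSq_eq_norm_sq, ← Complex.ofReal_pow,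
      EuclideanSpace.norm_sq_eq, Fin.sum_univ_two, Complex.ofReal_add]
  refine ⟨suMk (u 0 / ‖u‖) (u 1 / ‖u‖) ?_, ‖u‖, ?_⟩
  · simp only [map_div₀, Complex.conj_ofReal]
    field_simp
    exact hs
  · rw [fundRep_suMk]
    ext i
    fin_cases i <;> simp [hn]

/-- The diagonal matrix with entries `z, z⁻¹`. -/
def torus (z : Circle) : SU2 := suMk z 0 (by simp [Complex.mul_conj])

theorem fundRep_torus (z : Circle) (v : C2) (j : Fin 2) :
    fundRep (torus z) v j = (![z, (z : ℂ)⁻¹] : Fin 2 → ℂ) j * v j := by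
  rw [torus, fundRep_suMk, ← Circle.coe_inv, Circle.coe_inv_eq_conj]
  fin_cases j <;> simp

theorem coords_rho_torus (z : Circle) (x : L n) (p : Fin n → Fin 2) :
    TensorPow.coords n (L.incl n (rho n (torus z) x)) p
      = (z : ℂ) ^ (n - weight p) * (z : ℂ)⁻¹ ^ weight p * TensorPow.coords n (L.incl n x) p := by
  rw [incl_rho, TensorPow.coords_map_of_diagonal (fundRep_torus z), prod_comp_eq_pow_weight]
  rfl

theorem rho_torus_pow (z : Circle) :
    rho m (torus z) (L.pow m !₂[1, 0]) = (z : ℂ) ^ m • L.pow m !₂[1, 0] := by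
  have h : fundRep (torus z) !₂[1, 0] = (z : ℂ) • !₂[1, 0] := by
    ext j
    rw [fundRep_torus]
    fin_cases j <;> simp
  rw [rho_pow, h, L.pow_smul]

theorem eq_of_forall_circle_pow_eq {a b : ℕ} (h : ∀ z : Circle, z ^ a = z ^ b) : a = b := by
  by_contra hab
  have hne : (a - b : ℝ) ≠ 0 := sub_ne_zero.mpr (Nat.cast_injective.ne hab)
  refine Circle.exp_pi_ne_one ?_
  have hexp := h (Circle.exp (Real.pi / (a - b)))
  rwa [← Circle.exp_natCast_mul, ← Circle.exp_natCast_mul, ← div_eq_one, ← Circle.exp_sub,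
    ← sub_mul, mul_div_cancel₀ _ hne] at hexp

/-! ### Invariants in `L_m ⊗ F` -/

theorem eq_zero_of_contractLeft_pow_eq_zero {F : Type*} [NormedAddCommGroup F]
    [InnerProductSpace ℂ F] {σ : SU2 →* (F ≃ₗᵢ[ℂ] F)} {ξ : L m ⊗[ℂ] F}
    (hξ : ξ ∈ invariantTensors (rho m) σ) (h : contractLeft (L.pow m !₂[1, 0]) ξ = 0) :
    ξ = 0 := by
  refine eq_zero_of_contractLeft_eq_zero L.span_pow ?_
  rintro _ ⟨v, rfl⟩
  obtain ⟨g, a, rfl⟩ := exists_fundRep_eq v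
  rw [← rho_pow, contractLeft_apply_of_mem_invariantTensors hξ, L.pow_smul, map_smulₛₗ,
    LinearMap.smul_apply, h, smul_zero, map_zero]

theorem coords_contractLeft_pow_eq_zero {ξ : L m ⊗[ℂ] L n}
    (hξ : ξ ∈ invariantTensors (rho m) (rho n)) {p : Fin n → Fin 2} (hp : 2 * weight p ≠ m + n) :
    TensorPow.coords n (L.incl n (contractLeft (L.pow m !₂[1, 0]) ξ)) p = 0 := by
  set f : L n := contractLeft (L.pow m !₂[1, 0]) ξ
  have hweight (z : Circle) : (z : ℂ)⁻¹ ^ m • f = rho n (torus z) f := by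
    rw [← contractLeft_apply_of_mem_invariantTensors hξ, rho_torus_pow, map_smulₛₗ,
      LinearMap.smul_apply, map_pow, ← Circle.coe_inv, Circle.coe_inv_eq_conj]
  by_contra hne
  have hchar (z : Circle) : z⁻¹ ^ m = z ^ (n - weight p) * z⁻¹ ^ weight p := by
    have h := congrArg (fun x : L n => TensorPow.coords n (L.incl n x) p) (hweight z)
    simp only [coords_rho_torus, map_smul, PiLp.smul_apply, smul_eq_mul] at h
    exact Circle.ext (by simpa using mul_right_cancel₀ hne h)
  have hexp : weight p = m + (n - weight p) := eq_of_forall_circle_pow_eq fun z => by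
    rw [pow_add, ← inv_mul_eq_iff_eq_mul, ← eq_mul_inv_iff_mul_eq, ← inv_pow, ← inv_pow, hchar]
  have := weight_le p
  omega

theorem invariantTensors_rho_eq_bot_of_lt (h : n < m) :
    invariantTensors (rho m) (rho n) = ⊥ := by
  rw [Submodule.eq_bot_iff]
  intro ξ hξ
  refine eq_zero_of_contractLeft_pow_eq_zero hξ (L.ext_coords fun p => ?_)
  have := weight_le p
  rw [coords_contractLeft_pow_eq_zero hξ (by omega)]
  simp

theorem invariantTensors_rho_eq_bot (h : m ≠ n) : invariantTensors (rho m) (rho n) = ⊥ := by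
  rcases lt_or_gt_of_ne h with h | h
  · rw [Submodule.eq_bot_iff]
    intro ξ hξ
    have hcomm := comm_mem_invariantTensors hξ
    rwa [invariantTensors_rho_eq_bot_of_lt h, Submodule.mem_bot,
      LinearEquiv.map_eq_zero_iff] at hcomm
  · exact invariantTensors_rho_eq_bot_of_lt h

theorem exists_contractLeft_pow_eq_smul {ξ : L n ⊗[ℂ] L n} (hξ : ξ ∈ det (rho n)) :
    ∃ c : ℂ, contractLeft (L.pow n !₂[1, 0]) ξ = c • L.pow n !₂[0, 1] := by
  refine ⟨TensorPow.coords n (L.incl n (contractLeft (L.pow n !₂[1, 0]) ξ)) 1,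
    L.ext_coords fun p => ?_⟩
  rw [map_smul, map_smul, PiLp.smul_apply, L.coords_pow]
  by_cases hp : weight p = n
  · obtain rfl := eq_one_of_weight_eq hp
    simp [hp]
  · have := weight_le p
    rw [coords_contractLeft_pow_eq_zero hξ (by omega)]
    simp [show n - weight p ≠ 0 by omega]

theorem det_rho_eq_span_singleton {ζ : L n ⊗[ℂ] L n} (hζ : ζ ∈ det (rho n)) (hζ0 : ζ ≠ 0) :
    det (rho n) = ℂ ∙ ζ := by
  refine le_antisymm (fun ξ hξ => ?_) ((Submodule.span_singleton_le_iff_mem _ _).mpr hζ)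
  obtain ⟨a, ha⟩ := exists_contractLeft_pow_eq_smul hζ
  obtain ⟨b, hb⟩ := exists_contractLeft_pow_eq_smul hξ
  have ha0 : a ≠ 0 := by
    rintro rfl
    exact hζ0 (eq_zero_of_contractLeft_pow_eq_zero hζ (by rw [ha, zero_smul]))
  have hsub : a • ξ - b • ζ = 0 := by
    refine eq_zero_of_contractLeft_pow_eq_zero (σ := rho n)
      ((det (rho n)).sub_mem ((det (rho n)).smul_mem a hξ) ((det (rho n)).smul_mem b hζ)) ?_
    rw [map_sub, map_smul, map_smul, ha, hb, smul_comm, sub_self]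
  rw [← Submodule.smul_mem_iff _ ha0, sub_eq_zero.mp hsub]
  exact Submodule.smul_mem _ b (Submodule.mem_span_singleton_self ζ)

end

/-! ### The singlet in `L_n ⊗ L_n` -/

section

variable {n : ℕ}

/-- The bilinear form on `(ℂ²)^{⊗ n}` with
`(x₁ ⊗ ⋯ ⊗ xₙ, y₁ ⊗ ⋯ ⊗ yₙ) ↦ ∏ i, β xᵢ yᵢ`. -/
def TensorPow.form (n : ℕ) (β : C2 →ₗ[ℂ] C2 →ₗ[ℂ] ℂ) : TensorPow n →ₗ[ℂ] TensorPow n →ₗ[ℂ] ℂ :=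
  (PiTensorProduct.dualDistrib ∘ₗ PiTensorProduct.map fun _ => β :
    (⨂[ℂ] _ : Fin n, C2) →ₗ[ℂ] (⨂[ℂ] _ : Fin n, C2) →ₗ[ℂ] ℂ)

theorem TensorPow.form_tprod (β : C2 →ₗ[ℂ] C2 →ₗ[ℂ] ℂ) (x y : Fin n → C2) :
    TensorPow.form n β (TensorPow.tprod x) (TensorPow.tprod y) = ∏ i, β (x i) (y i) := by
  change PiTensorProduct.dualDistrib (PiTensorProduct.map (fun _ => β)
    (PiTensorProduct.tprod ℂ x)) (PiTensorProduct.tprod ℂ y) = _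
  rw [PiTensorProduct.map_tprod, PiTensorProduct.dualDistrib_apply]

theorem TensorPow.form_map {β : C2 →ₗ[ℂ] C2 →ₗ[ℂ] ℂ} {e : C2 ≃ₗᵢ[ℂ] C2}
    (he : ∀ v w, β (e v) (e w) = β v w) (x y : TensorPow n) :
    TensorPow.form n β (TensorPow.map n e x) (TensorPow.map n e y) = TensorPow.form n β x y := by
  let E : TensorPow n →ₗ[ℂ] TensorPow n := (TensorPow.map n e).toLinearEquiv.toLinearMap
  have h : (TensorPow.form n β).compl₁₂ E E = TensorPow.form n β :=
    TensorPow.linearMap_ext fun a => TensorPow.linearMap_ext fun b => by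
      simp [E, TensorPow.map_tprod, TensorPow.form_tprod, he]
  exact LinearMap.congr_fun₂ h x y

/-- The area form `(v, w) ↦ v₀ w₁ - v₁ w₀` on `ℂ²`. -/
def area : C2 →ₗ[ℂ] C2 →ₗ[ℂ] ℂ :=
  LinearMap.mk₂ ℂ (fun v w => v 0 * w 1 - v 1 * w 0)
    (fun _ _ _ => by simp; ring) (fun _ _ _ => by simp; ring)
    (fun _ _ _ => by simp; ring) (fun _ _ _ => by simp; ring)

theorem area_apply (v w : C2) : area v w = v 0 * w 1 - v 1 * w 0 := rfl

theorem area_fundRep (g : SU2) (v w : C2) : area (fundRep g v) (fundRep g w) = area v w := by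
  have hdet := (Matrix.mem_specialUnitaryGroup_iff.mp g.2).2
  rw [Matrix.det_fin_two] at hdet
  simp only [area_apply, fundRep_apply, Fin.sum_univ_two]
  linear_combination (v 0 * w 1 - v 1 * w 0) * hdet

/-- The vector of `L_n ⊗ L_n` that represents the `n`-th tensor power of the area form. -/
def singlet (n : ℕ) : L n ⊗[ℂ] L n :=
  (InnerProductSpace.toDual ℂ (L n ⊗[ℂ] L n)).symm <| LinearMap.toContinuousLinearMap <|
    TensorProduct.lift <| (TensorPow.form n area).compl₁₂
      (L.incl n).toLinearMap (L.incl n).toLinearMap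

theorem inner_singlet (x y : L n) :
    ⟪singlet n, x ⊗ₜ[ℂ] y⟫_ℂ = TensorPow.form n area (L.incl n x) (L.incl n y) := by
  simp [singlet]

theorem singlet_mem_det : singlet n ∈ det (rho n) :=
  mem_invariantTensors_of_inner_tmul (σ := rho n) fun g x y => by
    rw [inner_singlet, inner_singlet, incl_rho, incl_rho, TensorPow.form_map (area_fundRep g)]

theorem singlet_ne_zero : singlet n ≠ 0 := by
  intro h
  have hone : ⟪singlet n, L.pow n !₂[1, 0] ⊗ₜ[ℂ] L.pow n !₂[0, 1]⟫_ℂ = 1 := by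
    simp [inner_singlet, L.incl_pow, TensorPow.form_tprod, area_apply]
  simp [h] at hone

theorem eq_zero_of_mem_det_rho_of_inner_singlet_eq_zero {ω : L n ⊗[ℂ] L n}
    (hω : ω ∈ det (rho n)) (h : ⟪singlet n, ω⟫_ℂ = 0) : ω = 0 := by
  rw [det_rho_eq_span_singleton singlet_mem_det singlet_ne_zero,
    Submodule.mem_span_singleton] at hω
  obtain ⟨c, rfl⟩ := hω
  rw [inner_smul_right, mul_eq_zero, inner_self_eq_zero] at h
  rw [h.resolve_right singlet_ne_zero, zero_smul]

end

/-! ### The copies of `L_m` in `H` -/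

section

variable {H : Type*} [NormedAddCommGroup H] [InnerProductSpace ℂ H]
  {τ : SU2 →* (H ≃ₗᵢ[ℂ] H)} {k : ℕ → ℕ} {V : IsotypicSum k ≃ₗᵢ[ℂ] H}

/-- The `i`-th copy of `L_m` in `H`, where `s = (m, i)`. -/
def copy (V : IsotypicSum k ≃ₗᵢ[ℂ] H) (s : Σ m, Fin (k m)) : L s.1 →ₗᵢ[ℂ] H :=
  (summand V s.1).comp (copiesSingle s.2)

theorem copy_apply (s : Σ m, Fin (k m)) (x : L s.1) :
    copy V s x = V (lp.single (E := fun m => Copies (Fin (k m)) (L m)) 2 s.1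
      (PiLp.single 2 s.2 x)) := rfl

theorem inner_copy_apply (s : Σ m, Fin (k m)) (x : L s.1) (y : IsotypicSum k) :
    ⟪copy V s x, V y⟫_ℂ = ⟪x, y s.1 s.2⟫_ℂ := by
  rw [copy_apply, V.inner_map_map, lp.inner_single_left, PiLp.inner_apply,
    Finset.sum_eq_single s.2]
  · simp
  · intro i _ hi
    simp [hi]
  · simp

theorem copy_rho (hV : ∀ (g : SU2) (x : IsotypicSum k), V (isotypicRep k g x) = τ g (V x))
    (s : Σ m, Fin (k m)) (g : SU2) (x : L s.1) :
    copy V s (rho s.1 g x) = τ g (copy V s x) := by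
  refine ext_inner_right ℂ fun h => ?_
  obtain ⟨y, rfl⟩ := V.surjective h
  rw [inner_copy_apply, inner_apply_eq_inner_inv_apply, ← isotypicRep_apply,
    ← inner_copy_apply (V := V), hV, inner_apply_eq_inner_inv_apply]

variable (V) in
theorem orthogonalFamily_copy :
    OrthogonalFamily ℂ (fun s : Σ m, Fin (k m) => L s.1) (copy V) := by
  rintro ⟨m, i⟩ ⟨l, j⟩ hne x y
  by_cases hml : m = l
  · subst hml
    have hij : i ≠ j := fun h => hne (by rw [h])
    exact ((summand V m).inner_map_map _ _).trans (inner_copiesSingle hij x y)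
  · exact inner_summand V hml _ _

theorem eq_zero_of_inner_copy_eq_zero {h : H} (hh : ∀ s x, ⟪copy V s x, h⟫_ℂ = 0) : h = 0 := by
  obtain ⟨y, rfl⟩ := V.surjective h
  rw [LinearIsometryEquiv.map_eq_zero_iff]
  ext m i
  have hy := hh ⟨m, i⟩ (y m i)
  rwa [inner_copy_apply, inner_self_eq_zero] at hy

/-- The image in `H ⊗ H` of the singlet of the `i`-th and the `j`-th copy of `L_m`, where
`s = (m, (i, j))`. -/
def copySinglet (V : IsotypicSum k ≃ₗᵢ[ℂ] H) (s : Σ m, Fin (k m) × Fin (k m)) : H ⊗[ℂ] H :=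
  TensorProduct.mapIsometry (copy V ⟨s.1, s.2.1⟩) (copy V ⟨s.1, s.2.2⟩) (singlet s.1)

theorem copySinglet_ne_zero (s : Σ m, Fin (k m) × Fin (k m)) : copySinglet V s ≠ 0 :=
  (map_ne_zero_iff _ (LinearIsometry.injective _)).mpr singlet_ne_zero

theorem inner_copySinglet_eq_zero {s t : Σ m, Fin (k m) × Fin (k m)} (hne : s ≠ t) :
    ⟪copySinglet V s, copySinglet V t⟫_ℂ = 0 := by
  refine inner_map_map_eq_zero _ _ _ _ ?_ _ _
  by_cases h : (⟨s.1, s.2.1⟩ : Σ m, Fin (k m)) = ⟨t.1, t.2.1⟩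
  · refine Or.inr fun a b => orthogonalFamily_copy V (fun h' => hne ?_) a b
    grind
  · exact Or.inl fun a b => orthogonalFamily_copy V h a b

theorem linearIndependent_copySinglet : LinearIndependent ℂ (copySinglet V) :=
  linearIndependent_of_ne_zero_of_inner_eq_zero (𝕜 := ℂ) copySinglet_ne_zero
    fun _ _ => inner_copySinglet_eq_zero

theorem mapIsometry_copy_mem_det
    (hV : ∀ (g : SU2) (x : IsotypicSum k), V (isotypicRep k g x) = τ g (V x))
    {m : ℕ} (i j : Fin (k m)) {ζ : L m ⊗[ℂ] L m} (hζ : ζ ∈ det (rho m)) :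
    TensorProduct.mapIsometry (copy V ⟨m, i⟩) (copy V ⟨m, j⟩) ζ ∈ det τ :=
  map_mem_invariantTensors (π := rho m) (σ := rho m) (π' := τ) (σ' := τ)
    (copy_rho hV ⟨m, i⟩) (copy_rho hV ⟨m, j⟩) hζ

variable [FiniteDimensional ℂ H]

variable (V) in
theorem span_copy : Submodule.span ℂ {h : H | ∃ s x, copy V s x = h} = ⊤ := by
  rw [← Submodule.orthogonal_eq_bot_iff, Submodule.eq_bot_iff]
  intro h hh
  refine eq_zero_of_inner_copy_eq_zero (V := V) fun s x => ?_
  exact (Submodule.mem_orthogonal _ _).mp hh _ (Submodule.subset_span ⟨s, x, rfl⟩)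

variable (V) in
/-- The component of `ξ` in the tensor product of two of the copies. -/
def compress (s t : Σ m, Fin (k m)) : H ⊗[ℂ] H →ₗ[ℂ] L s.1 ⊗[ℂ] L t.1 :=
  TensorProduct.map (copy V s).toLinearMap.adjoint (copy V t).toLinearMap.adjoint

theorem inner_compress (s t : Σ m, Fin (k m)) (ω : L s.1 ⊗[ℂ] L t.1) (ξ : H ⊗[ℂ] H) :
    ⟪ω, compress V s t ξ⟫_ℂ = ⟪TensorProduct.mapIsometry (copy V s) (copy V t) ω, ξ⟫_ℂ := by
  rw [compress, ← TensorProduct.adjoint_map, LinearMap.adjoint_inner_right]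
  rfl

theorem eq_zero_of_compress_eq_zero {ξ : H ⊗[ℂ] H} (h : ∀ s t, compress V s t ξ = 0) :
    ξ = 0 := by
  refine eq_zero_of_contractLeft_eq_zero (span_copy V) ?_
  rintro _ ⟨s, x, rfl⟩
  refine eq_zero_of_inner_copy_eq_zero (V := V) fun t y => ?_
  rw [inner_contractLeft]
  exact (inner_compress s t (x ⊗ₜ y) ξ).symm.trans (by rw [h, inner_zero_right])

theorem compress_mem_invariantTensors
    (hV : ∀ (g : SU2) (x : IsotypicSum k), V (isotypicRep k g x) = τ g (V x))
    (s t : Σ m, Fin (k m)) {ξ : H ⊗[ℂ] H} (hξ : ξ ∈ det τ) :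
    compress V s t ξ ∈ invariantTensors (rho s.1) (rho t.1) :=
  map_mem_invariantTensors (π := τ) (σ := τ) (adjoint_apply_of_intertwining (copy_rho hV s))
    (adjoint_apply_of_intertwining (copy_rho hV t)) hξ

theorem eq_zero_of_mem_det_of_inner_copySinglet_eq_zero
    (hV : ∀ (g : SU2) (x : IsotypicSum k), V (isotypicRep k g x) = τ g (V x))
    {ξ : H ⊗[ℂ] H} (hξ : ξ ∈ det τ) (h : ∀ s, ⟪copySinglet V s, ξ⟫_ℂ = 0) : ξ = 0 := by
  refine eq_zero_of_compress_eq_zero (V := V) fun ⟨m, i⟩ ⟨l, j⟩ => ?_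
  have hinv := compress_mem_invariantTensors hV ⟨m, i⟩ ⟨l, j⟩ hξ
  by_cases hml : m = l
  · subst hml
    exact eq_zero_of_mem_det_rho_of_inner_singlet_eq_zero hinv
      ((inner_compress ⟨m, i⟩ ⟨m, j⟩ (singlet m) ξ).trans (h ⟨m, i, j⟩))
  · rwa [invariantTensors_rho_eq_bot hml, Submodule.mem_bot] at hinv

theorem span_copySinglet
    (hV : ∀ (g : SU2) (x : IsotypicSum k), V (isotypicRep k g x) = τ g (V x)) :
    Submodule.span ℂ (Set.range (copySinglet V)) = det τ := by
  have hle : Submodule.span ℂ (Set.range (copySinglet V)) ≤ det τ := by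
    rw [Submodule.span_le]
    rintro _ ⟨s, rfl⟩
    exact mapIsometry_copy_mem_det hV _ _ singlet_mem_det
  have hbot : (Submodule.span ℂ (Set.range (copySinglet V)))ᗮ ⊓ det τ = ⊥ := by
    rw [Submodule.eq_bot_iff]
    rintro ξ ⟨horth, hξ⟩
    exact eq_zero_of_mem_det_of_inner_copySinglet_eq_zero hV hξ fun s =>
      (Submodule.mem_orthogonal _ _).mp horth _ (Submodule.subset_span ⟨s, rfl⟩)
  rw [← Submodule.sup_orthogonal_inf_of_hasOrthogonalProjection hle, hbot, sup_bot_eq]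

end

/-! ### Dimension and the unitary isomorphism -/

theorem hasSum_one_card (α : Type*) [Fintype α] :
    HasSum (fun _ : α => 1) (Fintype.card α) := by
  rw [Fintype.card_eq_sum_ones]
  exact hasSum_fintype _

theorem hasSum_card_sigma {ι : Type*} (α : ι → Type*) [∀ i, Fintype (α i)] [Fintype (Σ i, α i)] :
    HasSum (fun i => Fintype.card (α i)) (Fintype.card (Σ i, α i)) :=
  (hasSum_one_card (Σ i, α i)).sigma fun i => hasSum_one_card (α i)

section

variable {H : Type*} [NormedAddCommGroup H] [InnerProductSpace ℂ H] [FiniteDimensional ℂ H]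
  {τ : SU2 →* (H ≃ₗᵢ[ℂ] H)} {k : ℕ → ℕ} {V : IsotypicSum k ≃ₗᵢ[ℂ] H}

theorem hasSum_finrank_det
    (hV : ∀ (g : SU2) (x : IsotypicSum k), V (isotypicRep k g x) = τ g (V x)) :
    HasSum (fun m => k m ^ 2) (Module.finrank ℂ (det τ)) := by
  have hli := linearIndependent_copySinglet (V := V)
  have : Finite (Σ m, Fin (k m) × Fin (k m)) := hli.finite
  have : Fintype (Σ m, Fin (k m) × Fin (k m)) := Fintype.ofFinite _
  rw [← span_copySinglet hV, finrank_span_eq_card hli]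
  simpa only [Fintype.card_prod, Fintype.card_fin, ← sq]
    using hasSum_card_sigma fun m => Fin (k m) × Fin (k m)

/-- The isometry `⨁_m (L_m ⊗ L_m)^{⊕ k_m²} → H ⊗ H`. -/
def squareSumIsometry (V : IsotypicSum k ≃ₗᵢ[ℂ] H) : SquareSum k →ₗᵢ[ℂ] H ⊗[ℂ] H :=
  (iota V).comp (squareSumEquiv k).toLinearIsometry

theorem hasSum_squareSumIsometry (x : SquareSum k) :
    HasSum (fun m => ∑ p : Fin (k m) × Fin (k m),
      TensorProduct.mapIsometry (copy V ⟨m, p.1⟩) (copy V ⟨m, p.2⟩) (x m p))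
      (squareSumIsometry V x) := by
  refine ((orthogonalFamily_summand V).hasSum_linearIsometry (squareSumEquiv k x)).congr_fun
    fun m => Eq.symm ?_
  change TensorProduct.mapIsometry (summand V m) (summand V m)
    (∑ p : Fin (k m) × Fin (k m),
      TensorProduct.mapIsometry (copiesSingle p.1) (copiesSingle p.2) (x m p)) = _
  rw [map_sum]
  refine Finset.sum_congr rfl fun p _ => ?_
  exact (LinearMap.congr_fun (TensorProduct.map_comp (summand V m).toLinearMap
    (summand V m).toLinearMap (copiesSingle p.1).toLinearMap (copiesSingle p.2).toLinearMap)
    (x m p)).symm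

variable (k) in
/-- The vector of `⨁_m (L_m ⊗ L_m)^{⊕ k_m²}` with the singlet in the summand `s` and zero in the
others. -/
def singletAt (s : Σ m, Fin (k m) × Fin (k m)) : SquareSum k :=
  lp.single 2 s.1 (PiLp.single 2 s.2 (singlet s.1))

theorem singletAt_self (s : Σ m, Fin (k m) × Fin (k m)) : singletAt k s s.1 s.2 = singlet s.1 := by
  rw [singletAt, lp.single_apply_self]
  simp

theorem singletAt_of_ne {s : Σ m, Fin (k m) × Fin (k m)} {m : ℕ} {p : Fin (k m) × Fin (k m)}
    (h : ⟨m, p⟩ ≠ s) : singletAt k s m p = 0 := by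
  obtain ⟨l, q⟩ := s
  by_cases hm : m = l
  · subst hm
    have hp : p ≠ q := fun hp => h (by rw [hp])
    rw [singletAt, lp.single_apply_self]
    simp [hp]
  · rw [singletAt, lp.single_apply_ne _ _ _ hm]
    rfl

theorem singletAt_mem_detSum (s : Σ m, Fin (k m) × Fin (k m)) : singletAt k s ∈ detSum k := by
  intro m p
  by_cases h : ⟨m, p⟩ = s
  · subst h
    rw [singletAt_self]
    exact singlet_mem_det
  · rw [singletAt_of_ne h]
    exact zero_mem _

theorem squareSumIsometry_singletAt (s : Σ m, Fin (k m) × Fin (k m)) :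
    squareSumIsometry V (singletAt k s) = copySinglet V s := by
  rw [← (hasSum_squareSumIsometry _).tsum_eq, tsum_eq_single s.1, Finset.sum_eq_single s.2]
  · rw [singletAt_self, copySinglet]
  · intro p _ hp
    rw [singletAt_of_ne fun h => hp (eq_of_heq (Sigma.ext_iff.mp h).2), map_zero]
  · simp
  · intro m hm
    refine Finset.sum_eq_zero fun p _ => ?_
    rw [singletAt_of_ne fun h => hm (congrArg Sigma.fst h), map_zero]

theorem map_detSum
    (hV : ∀ (g : SU2) (x : IsotypicSum k), V (isotypicRep k g x) = τ g (V x)) :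
    (detSum k).map (squareSumIsometry V).toLinearMap = det τ := by
  apply le_antisymm
  · rintro _ ⟨x, hx, rfl⟩
    exact (det τ).closed_of_finiteDimensional.mem_of_tendsto (hasSum_squareSumIsometry x)
      (Filter.Eventually.of_forall fun s => (det τ).sum_mem fun m _ => (det τ).sum_mem fun p _ =>
        mapIsometry_copy_mem_det hV _ _ (hx m p))
  · rw [← span_copySinglet hV, Submodule.span_le]
    rintro _ ⟨s, rfl⟩
    exact ⟨singletAt k s, singletAt_mem_detSum s, squareSumIsometry_singletAt s⟩

end

end SU2Det

end

theorem propositionp {H : Type*} [NormedAddCommGroup H] [InnerProductSpace ℂ H]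
    [FiniteDimensional ℂ H]
    (τ : SU2Det.SU2 →* (H ≃ₗᵢ[ℂ] H)) (hτ : ∀ x : H, Continuous fun g => τ g x)
    (k : ℕ → ℕ) (V : SU2Det.IsotypicSum k ≃ₗᵢ[ℂ] H)
    (hV : ∀ (g : SU2Det.SU2) (x : SU2Det.IsotypicSum k),
      V (SU2Det.isotypicRep k g x) = τ g (V x)) :
    HasSum (fun m => k m ^ 2) (Module.finrank ℂ (SU2Det.det τ)) ∧
    ∃ U : SU2Det.detSum k ≃ₗᵢ[ℂ] SU2Det.det τ,
      ∀ x : SU2Det.detSum k,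
        (U x : H ⊗[ℂ] H) = SU2Det.iota V (SU2Det.squareSumEquiv k (x : SU2Det.SquareSum k)) := by
  refine ⟨SU2Det.hasSum_finrank_det hV, ?_⟩
  let T := SU2Det.squareSumIsometry V
  let e : SU2Det.detSum k ≃ₗ[ℂ] SU2Det.det τ :=
    (Submodule.equivMapOfInjective T.toLinearMap T.injective (SU2Det.detSum k)).trans
      (LinearEquiv.ofEq _ _ (SU2Det.map_detSum hV))
  exact ⟨⟨e, fun x => T.norm_map x⟩, fun x => rfl⟩
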